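/- For $K\subseteq\mathbb{R}^n$ non-empty, compact and convex, let $h_K(a)=\sup\{\langle a,x\rangle : x\in K\}$ denote its support function. For $S\subseteq\mathbb{Z}^n$ put $$\mathrm{CC}(K,S)=\bigcap_{a\in S}\{x\in\mathbb{R}^n : \langle a,x\rangle\le\lfloor h_K(a)\rfloor\},$$ and let $\mathrm{CC}(K)=\mathrm{CC}(K,\mathbb{Z}^n)$ be the Chvátal–Gomory closure of $K$. **Theorem.** Let $K\subseteq\mathbb{R}^n$ be a non-empty compact convex set. Then $\mathrm{CC}(K)$ is finitely generated, that is, there is a finite set $S\subseteq\mathbb{Z}^n$ with $\mathrm{CC}(K)=\mathrm{CC}(K,S)$. In particular $\mathrm{CC}(K)$ is a (possibly empty) rational polytope, i.e. a bounded set of the form $\{x\in\mathbb{R}^n : Ax\le b\}$ with a rational matrix $A$ and a rational vector $b$. No rationality of $K$ is assumed; $K$ may for instance be a polytope with irrational vertices. -/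

import Mathlib

noncomputable section

/-- The integer vector `a ∈ ℤⁿ`, seen as a point of Euclidean space `ℝⁿ`. -/
def intVec {n : ℕ} (a : Fin n → ℤ) : EuclideanSpace ℝ (Fin n) :=
  WithLp.toLp 2 (fun i => (a i : ℝ))

/-- The support function `h_K(v) = sup {⟨v, x⟩ : x ∈ K}` of a set `K ⊆ ℝⁿ`. It takes real values;
the supremum is the true one whenever `K` is non-empty and bounded, in particular when `K` is
non-empty and compact. -/
def supportFn {n : ℕ} (K : Set (EuclideanSpace ℝ (Fin n))) (v : EuclideanSpace ℝ (Fin n)) : ℝ :=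
  sSup ((fun x => inner ℝ v x) '' K)

/-- `CC(K, S)`: the set of all points that satisfy, for every `a ∈ S`, the Chvátal–Gomory cut
`⟨a, x⟩ ≤ ⌊h_K(a)⌋`. -/
def cgCuts {n : ℕ} (K : Set (EuclideanSpace ℝ (Fin n))) (S : Set (Fin n → ℤ)) :
    Set (EuclideanSpace ℝ (Fin n)) :=
  ⋂ a ∈ S, {x | inner ℝ (intVec a) x ≤ (⌊supportFn K (intVec a)⌋ : ℝ)}

/-- The Chvátal–Gomory closure `CC(K) = CC(K, ℤⁿ)`. -/
def cgClosure {n : ℕ} (K : Set (EuclideanSpace ℝ (Fin n))) : Set (EuclideanSpace ℝ (Fin n)) :=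
  cgCuts K Set.univ

/-- A rational polyhedron: the solution set `{x ∈ ℝⁿ : A x ≤ b}` of a finite system of linear
inequalities with rational coefficients and rational right-hand sides. -/
def IsRationalPolyhedron {n : ℕ} (P : Set (EuclideanSpace ℝ (Fin n))) : Prop :=
  ∃ (m : ℕ) (A : Matrix (Fin m) (Fin n) ℚ) (b : Fin m → ℚ),
    P = {x | ∀ i, ∑ j, (A i j : ℝ) * x j ≤ (b i : ℝ)}

/-- A rational polytope: a bounded rational polyhedron (possibly empty). -/
def IsRationalPolytope {n : ℕ} (P : Set (EuclideanSpace ℝ (Fin n))) : Prop :=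
  IsRationalPolyhedron P ∧ Bornology.IsBounded P

end

open Filter Topology

/-! Lift x to (x, 1). A cut ⟨a, x⟩ ≤ k with k ≥ ⌊h_K(a)⌋ becomes an integer functional f = (a, -k)
that is < 1 on the lifted K, and the cut asserts f ≤ 0. This form makes sense for any discrete
spanning subgroup Γ and survives projection to suitable subspaces, which permits induction on the
dimension (`exists_finite_validCuts`).

Since the sphere of directions is compact, it suffices to imply, by finitely many cuts, all cuts
with direction near a given g. If g > 0 somewhere on K, those cuts are bounded in norm, hence finite
in number (`exists_nhds_finite_validCuts`). If g ≤ 0 on K, let V be the largest subspace inside the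
closure of Γ + ℝg; Γ is discrete modulo V (`exists_rational_hull`). Adding tg with t ≥ 0 never
spoils validity, so elements of Γ near tg + y, y ∈ V, yield cuts that force points with g ≥ 0 into
Vᗮ (`exists_validCuts_mem_orthogonal`) and lift cuts of K ∩ Vᗮ to K (`exists_validCuts_lift`). By
induction, finitely many cuts define a polytope on which g ≤ 0 and whose face g = 0 satisfies every
cut. At its finitely many other vertices g < 0, which leaves room to perturb g
(`exists_validCuts_nhds_of_face`). -/

section GeneralTheory

universe v

variable {E : Type v} [NormedAddCommGroup E] [InnerProductSpace ℝ E]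

/-! ### Polyhedra in the slice u = 1 and their vertices -/

/-- The polyhedron cut out of the hyperplane `⟨u, x⟩ = 1` by the inequalities `⟨f, x⟩ ≤ 0`, `f ∈ S`. -/
def slicedCone (u : E) (S : Set E) : Set E :=
  {x | inner ℝ u x = 1 ∧ ∀ f ∈ S, inner ℝ f x ≤ 0}

lemma slicedCone_anti (u : E) {S T : Set E} (h : S ⊆ T) : slicedCone u T ⊆ slicedCone u S :=
  fun _ hx => ⟨hx.1, fun f hf => hx.2 f (h hf)⟩

lemma isClosed_slicedCone (u : E) (S : Set E) : IsClosed (slicedCone u S) := by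
  have : slicedCone u S = {x | inner ℝ u x = 1} ∩ ⋂ f ∈ S, {x | inner ℝ f x ≤ 0} := by
    ext x; simp [slicedCone]
  rw [this]
  refine (isClosed_eq (by fun_prop) (by fun_prop)).inter ?_
  exact isClosed_biInter fun f _ => isClosed_le (by fun_prop) (by fun_prop)

lemma convex_slicedCone (u : E) (S : Set E) : Convex ℝ (slicedCone u S) := by
  intro x hx y hy a b ha hb hab
  refine ⟨?_, fun f hf => ?_⟩
  · simp [inner_add_right, inner_smul_right, hx.1, hy.1, hab]
  · have h1 := mul_nonpos_of_nonneg_of_nonpos ha (hx.2 f hf)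
    have h2 := mul_nonpos_of_nonneg_of_nonpos hb (hy.2 f hf)
    simp only [inner_add_right, inner_smul_right]
    linarith

/-- An extreme point of a polyhedron is determined by its set of active constraints. -/
lemma finite_extremePoints_slicedCone (u : E) {S : Set E} (hS : S.Finite) :
    ((slicedCone u S).extremePoints ℝ).Finite := by
  refine Set.Finite.of_injOn (f := fun x => {f ∈ S | inner ℝ f x = (0 : ℝ)})
    (t := {T | T ⊆ S}) (fun x _ => Set.sep_subset _ _) ?_ hS.finite_subsets
  intro x hx y hy hxy
  -- With equal active sets, x can be pushed slightly away from y inside the polyhedron. Then x lies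
  -- strictly between y and the new point, so extremality gives x = y.
  have hev : ∀ᶠ ε : ℝ in 𝓝[>] 0, ∀ f ∈ S, inner ℝ f (x + ε • (x - y)) ≤ (0 : ℝ) := by
    rw [eventually_all_finite hS]
    intro f hf
    rcases (hx.1.2 f hf).lt_or_eq with h | h
    · have hc : Tendsto (fun ε : ℝ => inner ℝ f (x + ε • (x - y))) (𝓝[>] 0)
          (𝓝 (inner ℝ f (x + (0 : ℝ) • (x - y)))) :=
        (Continuous.tendsto (by fun_prop) 0).mono_left nhdsWithin_le_nhds
      have : inner ℝ f (x + (0 : ℝ) • (x - y)) < 0 := by simpa using h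
      exact (hc.eventually_lt_const this).mono fun _ h => h.le
    · have hy' : f ∈ {f ∈ S | inner ℝ f y = (0 : ℝ)} := by
        have : f ∈ {f ∈ S | inner ℝ f x = (0 : ℝ)} := ⟨hf, h⟩
        simpa only [hxy] using this
      refine Eventually.of_forall fun ε => ?_
      simp [inner_add_right, inner_smul_right, inner_sub_right, h, hy'.2]
  obtain ⟨ε, hε, hε0⟩ := (hev.and self_mem_nhdsWithin).exists
  have hε0 : 0 < ε := hε0
  have hz : x + ε • (x - y) ∈ slicedCone u S :=
    ⟨by simp [inner_add_right, inner_smul_right, inner_sub_right, hx.1.1, hy.1.1], hε⟩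
  have hseg : x ∈ openSegment ℝ y (x + ε • (x - y)) := by
    refine ⟨ε / (1 + ε), 1 / (1 + ε), by positivity, by positivity, by field_simp; ring, ?_⟩
    have h1 : (1 + ε) ≠ 0 := by positivity
    have : (1 + ε) • x = (1 + ε) • ((ε / (1 + ε)) • y + (1 / (1 + ε)) • (x + ε • (x - y))) := by
      rw [smul_add, smul_smul, smul_smul, mul_div_cancel₀ _ h1, mul_div_cancel₀ _ h1]
      module
    exact (smul_right_injective E h1 this).symm
  exact (hx.2 hy.1 hz hseg).symm

lemma inner_nonpos_of_extremePoints {P : Set E} (hP : IsCompact P) (hc : Convex ℝ P) (f : E)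
    (h : ∀ x ∈ P.extremePoints ℝ, inner ℝ f x ≤ (0 : ℝ)) : ∀ x ∈ P, inner ℝ f x ≤ (0 : ℝ) := by
  have hcl : IsClosed {x : E | inner ℝ f x ≤ (0 : ℝ)} := isClosed_le (by fun_prop) (by fun_prop)
  have hcv : Convex ℝ {x : E | inner ℝ f x ≤ (0 : ℝ)} :=
    convex_halfSpace_le (innerₛₗ ℝ f).isLinear 0
  have := closure_minimal (convexHull_min h hcv) hcl
  rwa [closure_convexHull_extremePoints hP hc] at this

lemma OrthonormalBasis.isBounded_of_forall_inner {ι : Type*} [Fintype ι]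
    (b : OrthonormalBasis ι ℝ E) {P : Set E} (h : ∀ i, ∃ C : ℝ, ∀ x ∈ P, |inner ℝ (b i) x| ≤ C) :
    Bornology.IsBounded P := by
  choose C hC using h
  refine isBounded_iff_forall_norm_le.2 ⟨∑ i, C i, fun x hx => ?_⟩
  calc ‖x‖ = ‖∑ i, inner ℝ (b i) x • b i‖ := by rw [b.sum_repr']
    _ ≤ ∑ i, ‖inner ℝ (b i) x • b i‖ := norm_sum_le _ _
    _ ≤ ∑ i, C i := Finset.sum_le_sum fun i _ => by
        rw [norm_smul, b.norm_eq_one, mul_one]; exact hC i x hx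

/-! ### Valid cuts and boundedness -/

/-- The elements of `Γ` that are smaller than `1` on `K`. -/
def validCuts (Γ : AddSubgroup E) (K : Set E) : Set E :=
  {f | f ∈ Γ ∧ ∀ y ∈ K, inner ℝ f y < (1 : ℝ)}

lemma exists_abs_inner_le {K : Set E} (hK : IsCompact K) (e : E) :
    ∃ C : ℝ, ∀ y ∈ K, |inner ℝ e y| ≤ C := by
  obtain ⟨C, hC⟩ := hK.exists_bound_of_continuousOn (f := fun y => inner ℝ e y) (by fun_prop)
  exact ⟨C, fun y hy => hC y hy⟩

/-- On the slice u = 1, subtracting k • u subtracts the constant k. For k above the maximum of |f|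
on K, both ±f - k are negative on K, hence valid, and together they give |f| ≤ k. As Γ spans, this
bounds every functional. -/
lemma exists_validCuts_isBounded [FiniteDimensional ℝ E] {Γ : AddSubgroup E}
    (hspan : Submodule.span ℝ (Γ : Set E) = ⊤) {u : E} (hu : u ∈ Γ) {K : Set E}
    (hK : IsCompact K) (hKu : ∀ y ∈ K, inner ℝ u y = (1 : ℝ)) :
    ∃ S ⊆ validCuts Γ K, S.Finite ∧ Bornology.IsBounded (slicedCone u S) := by
  have key : ∀ e : E, ∃ S ⊆ validCuts Γ K, S.Finite ∧
      ∃ C : ℝ, ∀ x ∈ slicedCone u S, |inner ℝ e x| ≤ C := by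
    intro e
    have he : e ∈ Submodule.span ℝ (Γ : Set E) := by rw [hspan]; trivial
    induction he using Submodule.span_induction with
    | mem f hf =>
      obtain ⟨C, hC⟩ := exists_abs_inner_le hK f
      obtain ⟨k, hk⟩ := exists_nat_gt C
      have hku : k • u ∈ Γ := Γ.nsmul_mem hu k
      have hval : ∀ x, inner ℝ u x = (1 : ℝ) → inner ℝ (k • u) x = (k : ℝ) := by
        intro x hx
        rw [← Nat.cast_smul_eq_nsmul ℝ, inner_smul_left, hx]; simp
      refine ⟨{f - k • u, -f - k • u}, ?_, by simp, k, fun x hx => ?_⟩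
      · rintro _ (rfl | rfl)
        · refine ⟨Γ.sub_mem hf hku, fun y hy => ?_⟩
          rw [inner_sub_left, hval y (hKu y hy)]
          linarith [(abs_le.1 (hC y hy)).2]
        · refine ⟨Γ.sub_mem (Γ.neg_mem hf) hku, fun y hy => ?_⟩
          rw [inner_sub_left, hval y (hKu y hy), inner_neg_left]
          linarith [(abs_le.1 (hC y hy)).1]
      · have h1 := hx.2 (f - k • u) (by simp)
        have h2 := hx.2 (-f - k • u) (by simp)
        rw [inner_sub_left, hval x hx.1] at h1 h2
        rw [inner_neg_left] at h2
        exact abs_le.2 ⟨by linarith, by linarith⟩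
    | zero => exact ⟨∅, by simp, by simp, 0, by simp⟩
    | add a b _ _ iha ihb =>
      obtain ⟨S, hS, hSf, C, hC⟩ := iha
      obtain ⟨T, hT, hTf, D, hD⟩ := ihb
      refine ⟨S ∪ T, Set.union_subset hS hT, hSf.union hTf, C + D, fun x hx => ?_⟩
      rw [inner_add_left]
      exact (abs_add_le _ _).trans (add_le_add
        (hC x (slicedCone_anti u Set.subset_union_left hx))
        (hD x (slicedCone_anti u Set.subset_union_right hx)))
    | smul c a _ iha =>
      obtain ⟨S, hS, hSf, C, hC⟩ := iha
      refine ⟨S, hS, hSf, |c| * C, fun x hx => ?_⟩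
      rw [real_inner_smul_left, abs_mul]
      exact mul_le_mul_of_nonneg_left (hC x hx) (abs_nonneg c)
  choose S hS hSf C hC using key
  let b := stdOrthonormalBasis ℝ E
  refine ⟨⋃ i, S (b i), Set.iUnion_subset fun i => hS _, Set.finite_iUnion fun i => hSf _, ?_⟩
  exact b.isBounded_of_forall_inner fun i => ⟨C (b i), fun x hx =>
    hC _ x (slicedCone_anti u (Set.subset_iUnion (fun i => S (b i)) i) hx)⟩

/-! ### Subgroups of Euclidean space and Kronecker-type approximation -/

lemma finite_inter_closedBall_of_discrete [FiniteDimensional ℝ E] {Γ : AddSubgroup E}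
    (hΓ : ∃ ε > 0, ∀ f ∈ Γ, ‖f‖ < ε → f = 0) (R : ℝ) : {f | f ∈ Γ ∧ ‖f‖ ≤ R}.Finite := by
  obtain ⟨ε, hε, h⟩ := hΓ
  by_contra hinf
  let e := Set.Infinite.natEmbedding _ hinf
  obtain ⟨a, -, φ, hφ, hlim⟩ := (isCompact_closedBall (0 : E) R).tendsto_subseq
    (x := fun k : ℕ => (e k : E)) (fun k => by simpa using (e k).2.2)
  obtain ⟨N, hN⟩ := Metric.cauchySeq_iff'.1 hlim.cauchySeq ε hε
  have h1 := hN (N + 1) N.le_succ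
  rw [dist_eq_norm] at h1
  have h2 := sub_eq_zero.1 (h _ (Γ.sub_mem (e _).2.1 (e _).2.1) h1)
  have h3 := hφ.injective (e.injective (Subtype.ext h2))
  omega

/-- A line through the origin stays at bounded distance from a spanning subgroup. -/
lemma exists_bound_smul_sub {Γ : AddSubgroup E} {g : E}
    (hg : g ∈ Submodule.span ℝ (Γ : Set E)) :
    ∃ R : ℝ, ∀ t : ℝ, ∃ p ∈ Γ, ‖t • g - p‖ ≤ R := by
  induction hg using Submodule.span_induction with
  | mem f hf =>
    refine ⟨‖f‖, fun t => ⟨⌊t⌋ • f, Γ.zsmul_mem hf _, ?_⟩⟩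
    rw [← Int.cast_smul_eq_zsmul ℝ, ← sub_smul, norm_smul, Real.norm_eq_abs]
    refine mul_le_of_le_one_left (norm_nonneg f) ?_
    rw [Int.self_sub_floor, abs_of_nonneg (Int.fract_nonneg t)]
    exact (Int.fract_lt_one t).le
  | zero => exact ⟨0, fun t => ⟨0, Γ.zero_mem, by simp⟩⟩
  | add a b _ _ iha ihb =>
    obtain ⟨R, hR⟩ := iha
    obtain ⟨R', hR'⟩ := ihb
    refine ⟨R + R', fun t => ?_⟩
    obtain ⟨p, hp, h⟩ := hR t
    obtain ⟨q, hq, h'⟩ := hR' t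
    refine ⟨p + q, Γ.add_mem hp hq, ?_⟩
    rw [smul_add, add_sub_add_comm]
    exact (norm_add_le _ _).trans (add_le_add h h')
  | smul c a _ iha =>
    obtain ⟨R, hR⟩ := iha
    refine ⟨R, fun t => ?_⟩
    rw [smul_smul]
    exact hR _

/-- Recurrence of a ray modulo a spanning subgroup. -/
lemma exists_norm_sub_smul_lt [FiniteDimensional ℝ E] {Γ : AddSubgroup E} {g : E}
    (hg : g ∈ Submodule.span ℝ (Γ : Set E)) (T : ℝ) {ε : ℝ} (hε : 0 < ε) :
    ∃ p ∈ Γ, ∃ t ≥ T, ‖p - t • g‖ < ε := by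
  obtain ⟨R, hR⟩ := exists_bound_smul_sub hg
  choose p hp hpR using fun k : ℕ => hR k
  -- The remainders k • g - p k are bounded, so two of them with indices far apart nearly agree;
  -- their difference gives the recurrence.
  obtain ⟨a, -, φ, hφ, hlim⟩ := (isCompact_closedBall (0 : E) R).tendsto_subseq
    (x := fun k : ℕ => (k : ℝ) • g - p k) (fun k => by simpa using hpR k)
  obtain ⟨N, hN⟩ := Metric.cauchySeq_iff'.1 hlim.cauchySeq ε hε
  obtain ⟨M, hM⟩ := exists_nat_ge (T + φ N)
  let m := max N M
  have h1 : (M : ℝ) ≤ φ m := by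
    exact_mod_cast (le_max_right N M).trans (hφ.id_le m)
  refine ⟨p (φ m) - p (φ N), Γ.sub_mem (hp _) (hp _), φ m - φ N, by linarith, ?_⟩
  have hlt : ‖((φ m : ℝ) • g - p (φ m)) - ((φ N : ℝ) • g - p (φ N))‖ < ε := by
    rw [← dist_eq_norm]; exact hN m (le_max_left _ _)
  rw [← norm_neg] at hlt
  have heq : p (φ m) - p (φ N) - ((φ m : ℝ) - φ N) • g =
      -(((φ m : ℝ) • g - p (φ m)) - ((φ N : ℝ) • g - p (φ N))) := by module
  rw [heq]
  exact hlt

/-- The largest linear subspace contained in an additive subgroup. -/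
def AddSubgroup.maxSubspace (A : AddSubgroup E) : Submodule ℝ E where
  carrier := {y | ∀ s : ℝ, s • y ∈ A}
  add_mem' ha hb s := by rw [smul_add]; exact A.add_mem (ha s) (hb s)
  zero_mem' s := by rw [smul_zero]; exact A.zero_mem
  smul_mem' c x hx s := by rw [smul_smul]; exact hx _

lemma AddSubgroup.mem_of_mem_maxSubspace {A : AddSubgroup E} {y : E} (hy : y ∈ A.maxSubspace) :
    y ∈ A := by simpa using hy 1

/-- A closed subgroup is discrete modulo the largest subspace that it contains. -/
lemma exists_pos_forall_mem_maxSubspace [FiniteDimensional ℝ E] {A : AddSubgroup E}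
    (hA : IsClosed (A : Set E)) :
    ∃ ε > 0, ∀ a ∈ A, ‖A.maxSubspaceᗮ.starProjection a‖ < ε → a ∈ A.maxSubspace := by
  set V := A.maxSubspace with hV
  have hproj : ∀ a ∈ A, Vᗮ.starProjection a ∈ A := fun a ha => by
    have : Vᗮ.starProjection a = a - V.starProjection a := by
      rw [Submodule.starProjection_orthogonal]; simp
    rw [this]
    exact A.sub_mem ha (A.mem_of_mem_maxSubspace (V.starProjection_apply_mem a))
  by_contra! hcon
  have hcon' : ∀ k : ℕ, ∃ b ∈ A, b ∈ Vᗮ ∧ b ≠ 0 ∧ ‖b‖ < 1 / ((k : ℝ) + 1) := by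
    intro k
    obtain ⟨a, ha, hlt, hna⟩ := hcon (1 / ((k : ℝ) + 1)) (by positivity)
    refine ⟨_, hproj a ha, Submodule.starProjection_apply_mem _ _, fun h0 => hna ?_, hlt⟩
    rw [Submodule.starProjection_apply_eq_zero_iff, Submodule.orthogonal_orthogonal] at h0
    exact h0
  choose b hbA hbV hb0 hblt using hcon'
  have hb : Tendsto (fun k => ‖b k‖) atTop (𝓝 0) :=
    squeeze_zero (fun _ => norm_nonneg _) (fun k => (hblt k).le)
      tendsto_one_div_add_atTop_nhds_zero_nat
  have hn : ∀ k, ‖b k‖ ≠ 0 := fun k => norm_ne_zero_iff.2 (hb0 k)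
  obtain ⟨v, hv, φ, hφ, hlim⟩ := (isCompact_sphere (0 : E) 1).tendsto_subseq
    (x := fun k => ‖b k‖⁻¹ • b k) (fun k => by
      rw [mem_sphere_zero_iff_norm, norm_smul, norm_inv, norm_norm, inv_mul_cancel₀ (hn k)])
  -- Integer multiples of ever shorter vectors `b k` fill the whole limiting line: s • v is the
  -- limit of ⌊s / ‖b‖⌋ • b. So v is a unit vector in both V and Vᗮ.
  have hvV : v ∈ V := by
    intro s
    have hl : Tendsto (fun k => ⌊s * ‖b (φ k)‖⁻¹⌋ • b (φ k)) atTop (𝓝 (s • v)) := by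
      have h1 := hlim.const_smul s
      have h2 : Tendsto (fun k => Int.fract (s * ‖b (φ k)‖⁻¹) • b (φ k)) atTop (𝓝 0) := by
        refine squeeze_zero_norm (fun k => ?_) (hb.comp hφ.tendsto_atTop)
        rw [norm_smul, Real.norm_eq_abs, abs_of_nonneg (Int.fract_nonneg _)]
        exact mul_le_of_le_one_left (norm_nonneg _) (Int.fract_lt_one _).le
      have h3 := h1.sub h2
      rw [sub_zero] at h3
      refine h3.congr fun k => ?_
      simp only [Function.comp]
      rw [smul_smul, ← sub_smul, Int.self_sub_fract, Int.cast_smul_eq_zsmul]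
    exact hA.mem_of_tendsto hl (Eventually.of_forall fun k => A.zsmul_mem (hbA _) _)
  have hvV' : v ∈ Vᗮ := Vᗮ.closed_of_finiteDimensional.mem_of_tendsto hlim
    (Eventually.of_forall fun k => Vᗮ.smul_mem _ (hbV _))
  have : v = 0 := by
    have := V.inf_orthogonal_eq_bot.le ⟨hvV, hvV'⟩
    simpa using this
  rw [mem_sphere_zero_iff_norm, this, norm_zero] at hv
  exact zero_ne_one hv

/-- For a direction `g` and a spanning subgroup `Γ`, there is a subspace `V ∋ g` in which the
elements of `Γ` come arbitrarily close to each translate of the ray spanned by `g`, and modulo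
which `Γ` is discrete. -/
lemma exists_rational_hull [FiniteDimensional ℝ E] {Γ : AddSubgroup E}
    (hspan : Submodule.span ℝ (Γ : Set E) = ⊤) (g : E) :
    ∃ V : Submodule ℝ E, g ∈ V ∧
      (∃ ε > 0, ∀ f ∈ Γ, ‖Vᗮ.starProjection f‖ < ε → f ∈ V) ∧
      ∀ y ∈ V, ∀ ε > 0, ∃ p ∈ Γ, p ∈ V ∧ ∃ t : ℝ, 0 ≤ t ∧ ‖p - t • g - y‖ < ε := by
  let B : AddSubgroup E := Γ ⊔ (Submodule.span ℝ {g}).toAddSubgroup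
  let A : AddSubgroup E := B.topologicalClosure
  have hBA : ∀ x ∈ B, x ∈ A := fun x hx => B.le_topologicalClosure hx
  have hgB : ∀ t : ℝ, t • g ∈ B := fun t =>
    AddSubgroup.mem_sup_right (Submodule.smul_mem _ t (Submodule.mem_span_singleton_self g))
  have hΓB : ∀ p ∈ Γ, p ∈ B := fun p hp => AddSubgroup.mem_sup_left hp
  obtain ⟨ε₀, hε₀, hdisc⟩ := exists_pos_forall_mem_maxSubspace (A := A)
    B.isClosed_topologicalClosure
  have hgV : g ∈ A.maxSubspace := fun t => hBA _ (hgB t)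
  have hnear : ∀ p ∈ Γ, ∀ t : ℝ, ∀ y ∈ A.maxSubspace, ‖p - t • g - y‖ < ε₀ →
      p ∈ A.maxSubspace := by
    intro p hp t y hy hlt
    refine hdisc p (hBA _ (hΓB p hp)) (lt_of_le_of_lt ?_ hlt)
    have hz : A.maxSubspaceᗮ.starProjection (t • g + y) = 0 := by
      rw [Submodule.starProjection_apply_eq_zero_iff, Submodule.orthogonal_orthogonal]
      exact Submodule.add_mem _ (Submodule.smul_mem _ _ hgV) hy
    have : A.maxSubspaceᗮ.starProjection p = A.maxSubspaceᗮ.starProjection (p - t • g - y) := by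
      rw [sub_sub, map_sub, hz, sub_zero]
    rw [this]
    exact Submodule.norm_starProjection_apply_le _ _
  refine ⟨A.maxSubspace, hgV, ⟨ε₀, hε₀, fun f hf => hdisc f (hBA _ (hΓB f hf))⟩, ?_⟩
  intro y hy ε hε
  have hyA : y ∈ closure (B : Set E) := A.mem_of_mem_maxSubspace hy
  obtain ⟨q, hq, hqlt⟩ := Metric.mem_closure_iff.1 hyA (min (ε / 2) ε₀) (by positivity)
  obtain ⟨p, hp, r, hr, rfl⟩ := AddSubgroup.mem_sup.1 hq
  obtain ⟨s, rfl⟩ := Submodule.mem_span_singleton.1 hr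
  rw [dist_comm, dist_eq_norm] at hqlt
  have e1 : p + s • g - y = p - (-s) • g - y := by module
  rw [e1] at hqlt
  -- The coefficient -s of g may be negative; a return p' close to t • g with t ≥ s makes it t - s ≥
  -- 0.
  obtain ⟨p', hp', t, ht, hlt⟩ := exists_norm_sub_smul_lt (Γ := Γ) (g := g)
    (by rw [hspan]; trivial) s (ε := min (ε / 2) ε₀) (by positivity)
  refine ⟨p + p', Γ.add_mem hp hp', Submodule.add_mem _
    (hnear p hp _ y hy (hqlt.trans_le (min_le_right _ _)))
    (hnear p' hp' t 0 (Submodule.zero_mem _) ?_), t - s, by linarith, ?_⟩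
  · rw [sub_zero]; exact hlt.trans_le (min_le_right _ _)
  · have : p + p' - (t - s) • g - y = (p - (-s) • g - y) + (p' - t • g) := by module
    rw [this]
    have := norm_add_le (p - (-s) • g - y) (p' - t • g)
    have h1 := hqlt.trans_le (min_le_left _ _)
    have h2 := hlt.trans_le (min_le_left _ _)
    linarith

/-! ### Cuts on the section by Vᗮ -/

/-- A linear functional that is smaller than `1` on the part of a compact convex set orthogonal
to `V` can be modified by an element of `V` so as to be smaller than `1` on the whole set. -/
lemma exists_add_inner_lt_one [FiniteDimensional ℝ E] {K : Set E} (hK : IsCompact K)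
    (hc : Convex ℝ K) (V : Submodule ℝ E) (w : E)
    (hw : ∀ x ∈ K, x ∈ Vᗮ → inner ℝ w x < (1 : ℝ)) :
    ∃ y ∈ V, ∀ x ∈ K, inner ℝ (w + y) x < (1 : ℝ) := by
  let F : E →ₗ[ℝ] E × ℝ := LinearMap.id.prod (innerₛₗ ℝ w)
  have hF : ∀ x, F x = (x, inner ℝ w x) := fun x => rfl
  have hFc : Continuous F := by
    have : (F : E → E × ℝ) = fun x => (x, inner ℝ w x) := rfl
    rw [this]; fun_prop
  have hdisj : Disjoint (F '' K) ((Vᗮ : Set E) ×ˢ Set.Ici (1 : ℝ)) := by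
    rw [Set.disjoint_left]
    rintro _ ⟨x, hx, rfl⟩ ⟨h1, h2⟩
    exact absurd (hw x hx h1) (not_lt.2 h2)
  -- Separate the graph of w over K from Vᗮ × [1, ∞). The separating functional is (y, s) with y ∈ V
  -- and s ≥ 0.
  obtain ⟨φ, c, d, h1, hcd, h2⟩ := geometric_hahn_banach_compact_closed (hc.linear_image F)
    (hK.image hFc) ((Vᗮ.convex).prod (convex_Ici (1 : ℝ)))
    (Vᗮ.closed_of_finiteDimensional.prod isClosed_Ici) hdisj
  set s : ℝ := φ (0, 1)
  let ψ : E →L[ℝ] ℝ := φ.comp (ContinuousLinearMap.inl ℝ E ℝ)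
  let y : E := (InnerProductSpace.toDual ℝ E).symm ψ
  have hφ : ∀ x r, φ (x, r) = inner ℝ y x + r * s := by
    intro x r
    have : (x, r) = (x, (0 : ℝ)) + r • ((0 : E), (1 : ℝ)) := by simp
    rw [this, map_add, map_smul, InnerProductSpace.toDual_symm_apply]
    rfl
  have hK1 : ∀ x ∈ K, inner ℝ y x + inner ℝ w x * s < c := fun x hx => by
    rw [← hφ]; exact h1 _ ⟨x, hx, rfl⟩
  have hL : ∀ l ∈ Vᗮ, ∀ r : ℝ, 1 ≤ r → d < inner ℝ y l + r * s := fun l hl r hr => by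
    rw [← hφ]; exact h2 _ ⟨hl, hr⟩
  have hs0 : 0 ≤ s := by
    by_contra! hneg
    have := hL 0 Vᗮ.zero_mem (max 1 (d / s)) (le_max_left _ _)
    rw [inner_zero_right, zero_add] at this
    have h3 := mul_le_mul_of_nonpos_right (le_max_right 1 (d / s)) hneg.le
    rw [div_mul_cancel₀ _ hneg.ne] at h3
    linarith
  have hyV : y ∈ V := by
    rw [← Submodule.orthogonal_orthogonal V, Submodule.mem_orthogonal']
    intro l hl
    by_contra hne
    have := hL (((d - s) / inner ℝ y l) • l) (Vᗮ.smul_mem _ hl) 1 le_rfl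
    rw [inner_smul_right, div_mul_cancel₀ _ hne] at this
    linarith
  have hds : d < s := by simpa using hL 0 Vᗮ.zero_mem 1 le_rfl
  rcases hs0.lt_or_eq with hpos | hzero
  · refine ⟨s⁻¹ • y, V.smul_mem _ hyV, fun x hx => ?_⟩
    rw [inner_add_left, real_inner_smul_left]
    have := hK1 x hx
    have h4 : s * (inner ℝ w x + s⁻¹ * inner ℝ y x) < s * 1 := by
      rw [mul_add, mul_inv_cancel_left₀ hpos.ne']; linarith
    exact lt_of_mul_lt_mul_left h4 hpos.le
  -- A vertical separating hyperplane: y < c < 0 on K, so a large multiple of y outweighs w.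
  · obtain ⟨C, hC⟩ := exists_abs_inner_le hK w
    have hcneg : c < 0 := by linarith
    refine ⟨(C / (-c)) • y, V.smul_mem _ hyV, fun x hx => ?_⟩
    rw [inner_add_left, real_inner_smul_left]
    have h5 := hK1 x hx
    rw [← hzero, mul_zero, add_zero] at h5
    have h6 := abs_le.1 (hC x hx)
    have hC0 : 0 ≤ C := (abs_nonneg _).trans (hC x hx)
    have h7 : C / (-c) * inner ℝ y x ≤ C / (-c) * c :=
      mul_le_mul_of_nonneg_left h5.le (div_nonneg hC0 (by linarith))
    have hc0 : c ≠ 0 := hcneg.ne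
    have h8 : C / (-c) * c = -C := by field_simp
    linarith

lemma inner_sub_le_mul {a b y : E} {ε R : ℝ} (h : ‖a - b‖ ≤ ε) (hy : ‖y‖ ≤ R) :
    |inner ℝ a y - inner ℝ b y| ≤ ε * R := by
  rw [← inner_sub_left]
  exact (abs_real_inner_le_norm _ _).trans
    (mul_le_mul h hy (norm_nonneg _) ((norm_nonneg _).trans h))

/-- Finitely many valid cuts confine the half-space `⟨g, x⟩ ≥ 0` to the orthogonal complement of
the subspace `V`, provided the elements of `Γ` approximate all translates of the ray of `g` in
`V`. -/
lemma exists_validCuts_mem_orthogonal [FiniteDimensional ℝ E] {Γ : AddSubgroup E} {K : Set E}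
    (hK : IsCompact K) {V : Submodule ℝ E} {g : E} (hgV : g ∈ V)
    (hgK : ∀ y ∈ K, inner ℝ g y ≤ (0 : ℝ))
    (happ : ∀ y ∈ V, ∀ ε > 0, ∃ p ∈ Γ, p ∈ V ∧ ∃ t : ℝ, 0 ≤ t ∧ ‖p - t • g - y‖ < ε) :
    ∃ S ⊆ validCuts Γ K, S.Finite ∧
      ∀ x, (∀ f ∈ S, inner ℝ f x ≤ (0 : ℝ)) → 0 ≤ (inner ℝ g x : ℝ) → x ∈ Vᗮ := by
  obtain ⟨R, hR, hKR⟩ := hK.isBounded.exists_pos_norm_le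
  let Z : Set E := Metric.sphere 0 1 ∩ ((V : Set E) ∩ {x | 0 ≤ (inner ℝ g x : ℝ)})
  have hZ : IsCompact Z := (isCompact_sphere 0 1).inter_right
    (V.closed_of_finiteDimensional.inter (isClosed_le (by fun_prop) (by fun_prop)))
  obtain ⟨S, hS, hSf, hcov⟩ := hZ.elim_finite_subcover_image
    (b := {f | f ∈ validCuts Γ K ∧ f ∈ V}) (c := fun f => {x | 0 < (inner ℝ f x : ℝ)})
    (fun f _ => isOpen_lt (by fun_prop) (by fun_prop)) (by
      rintro x ⟨hx1, hxV, hgx⟩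
      rw [mem_sphere_zero_iff_norm] at hx1
      have hgx : 0 ≤ (inner ℝ g x : ℝ) := hgx
      -- With p within δ/2 of t • g + δ • x, on K the value of p is at most δR + δR/2 = 3/4 < 1,
      -- while at x it is at least δ - δ/2 > 0.
      set δ : ℝ := 1 / (2 * R) with hδ
      have hδ0 : 0 < δ := by positivity
      have hδR : δ * R = 1 / 2 := by rw [hδ]; field_simp
      obtain ⟨p, hp, hpV, t, ht, hlt⟩ := happ (δ • x) (V.smul_mem _ hxV) (δ / 2) (by positivity)
      rw [sub_sub] at hlt
      have hin : ∀ y : E, inner ℝ (t • g + δ • x) y = t * inner ℝ g y + δ * inner ℝ x y := by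
        intro y; rw [inner_add_left, real_inner_smul_left, real_inner_smul_left]
      refine Set.mem_biUnion (x := p) ⟨⟨hp, fun y hy => ?_⟩, hpV⟩ ?_
      · have h1 := (abs_le.1 (inner_sub_le_mul hlt.le (hKR y hy))).2
        rw [hin] at h1
        have h2 := mul_nonpos_of_nonneg_of_nonpos ht (hgK y hy)
        have h3 : inner ℝ x y ≤ R := by
          refine (real_inner_le_norm x y).trans ?_
          rw [hx1, one_mul]; exact hKR y hy
        have h4 := mul_le_mul_of_nonneg_left h3 hδ0.le
        linarith
      · have h1 := (abs_le.1 (inner_sub_le_mul hlt.le hx1.le)).1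
        rw [hin, real_inner_self_eq_norm_sq, hx1] at h1
        have h2 := mul_nonneg ht hgx
        show 0 < (inner ℝ p x : ℝ)
        linarith)
  refine ⟨S, fun f hf => (hS hf).1, hSf, fun x hxS hgx => ?_⟩
  have hproj : ∀ f ∈ V, (inner ℝ f (V.starProjection x) : ℝ) = inner ℝ f x := fun f hf => by
    rw [← Submodule.inner_starProjection_left_eq_right, Submodule.starProjection_eq_self_iff.2 hf]
  rw [← Submodule.starProjection_apply_eq_zero_iff]
  by_contra hne
  have hn : 0 < ‖V.starProjection x‖ := norm_pos_iff.2 hne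
  have hz : ‖V.starProjection x‖⁻¹ • V.starProjection x ∈ Z := by
    refine ⟨?_, V.smul_mem _ (V.starProjection_apply_mem x), ?_⟩
    · rw [mem_sphere_zero_iff_norm, norm_smul, norm_inv, norm_norm, inv_mul_cancel₀ hn.ne']
    · show 0 ≤ (inner ℝ g (‖V.starProjection x‖⁻¹ • V.starProjection x) : ℝ)
      rw [inner_smul_right, hproj g hgV]
      positivity
  obtain ⟨f, hf, hfz⟩ := Set.mem_iUnion₂.1 (hcov hz)
  have hfz : 0 < (inner ℝ f (‖V.starProjection x‖⁻¹ • V.starProjection x) : ℝ) := hfz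
  rw [inner_smul_right, hproj f (hS hf).2] at hfz
  have := mul_nonpos_of_nonneg_of_nonpos (inv_nonneg.2 hn.le) (hxS f hf)
  linarith

/-- Valid cuts for the section of `K` by `Vᗮ` lift to valid cuts for `K`. -/
lemma exists_validCuts_lift [FiniteDimensional ℝ E] {Γ : AddSubgroup E} {K : Set E}
    (hK : IsCompact K) (hc : Convex ℝ K) {V : Submodule ℝ E} {g : E}
    (hgK : ∀ y ∈ K, inner ℝ g y ≤ (0 : ℝ))
    (happ : ∀ y ∈ V, ∀ ε > 0, ∃ p ∈ Γ, p ∈ V ∧ ∃ t : ℝ, 0 ≤ t ∧ ‖p - t • g - y‖ < ε)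
    {w : E} (hw : w ∈ Γ) (hwK : ∀ x ∈ K, x ∈ Vᗮ → inner ℝ w x < (1 : ℝ)) :
    ∃ f ∈ validCuts Γ K, f - w ∈ V := by
  obtain ⟨R, hR, hKR⟩ := hK.isBounded.exists_pos_norm_le
  obtain ⟨y, hyV, hy⟩ := exists_add_inner_lt_one hK hc V w hwK
  -- Compactness turns the strict bound into a gap η, half of which absorbs the approximation error.
  obtain ⟨η, hη, hgap⟩ : ∃ η > 0, ∀ x ∈ K, inner ℝ (w + y) x ≤ 1 - η := by
    rcases K.eq_empty_or_nonempty with rfl | hne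
    · exact ⟨1, one_pos, by simp⟩
    · obtain ⟨z, hz, hmax⟩ := hK.exists_isMaxOn hne
        (f := fun x => (inner ℝ (w + y) x : ℝ)) (by fun_prop)
      refine ⟨1 - inner ℝ (w + y) z, by linarith [hy z hz], fun x hx => ?_⟩
      have : inner ℝ (w + y) x ≤ (inner ℝ (w + y) z : ℝ) := hmax hx
      linarith
  obtain ⟨p, hp, hpV, t, ht, hlt⟩ := happ y hyV (η / (2 * R)) (by positivity)
  refine ⟨w + p, ⟨Γ.add_mem hw hp, fun x hx => ?_⟩, by simpa using hpV⟩
  rw [sub_sub] at hlt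
  have h1 := (abs_le.1 (inner_sub_le_mul hlt.le (hKR x hx))).2
  have h2 : η / (2 * R) * R = η / 2 := by field_simp
  have h3 := mul_nonpos_of_nonneg_of_nonpos ht (hgK x hx)
  have h4 := hgap x hx
  rw [inner_add_left] at h4 ⊢
  rw [inner_add_left, real_inner_smul_left] at h1
  linarith

/-- If the cuts for the section of `K` by `Vᗮ` are finitely generated, then finitely many cuts
for `K` imply every cut on the face where `g` vanishes. -/
lemma exists_validCuts_face [FiniteDimensional ℝ E] {Γ : AddSubgroup E} {u : E} {K : Set E}
    (hK : IsCompact K) (hc : Convex ℝ K) {V : Submodule ℝ E} {g : E} (hgV : g ∈ V)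
    (hgK : ∀ y ∈ K, inner ℝ g y ≤ (0 : ℝ))
    (happ : ∀ y ∈ V, ∀ ε > 0, ∃ p ∈ Γ, p ∈ V ∧ ∃ t : ℝ, 0 ≤ t ∧ ‖p - t • g - y‖ < ε)
    {T : Set Vᗮ}
    (hT : T ⊆ validCuts (Γ.map (Vᗮ.orthogonalProjectionOnto : E →+ Vᗮ)) ((↑) ⁻¹' K))
    (hTf : T.Finite)
    (hgen : ∀ x ∈ slicedCone (Vᗮ.orthogonalProjectionOnto u) T,
      ∀ f ∈ validCuts (Γ.map (Vᗮ.orthogonalProjectionOnto : E →+ Vᗮ)) ((↑) ⁻¹' K),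
        inner ℝ f x ≤ (0 : ℝ)) :
    ∃ S ⊆ validCuts Γ K, S.Finite ∧ ∀ x ∈ slicedCone u S, inner ℝ g x ≤ (0 : ℝ) ∧
      (inner ℝ g x = (0 : ℝ) → ∀ f ∈ validCuts Γ K, inner ℝ f x ≤ (0 : ℝ)) := by
  have hinn : ∀ (f : E) (x : Vᗮ),
      (inner ℝ (Vᗮ.orthogonalProjectionOnto f) x : ℝ) = inner ℝ f (x : E) := fun f x => by
    rw [Submodule.inner_orthogonalProjectionOnto_eq_of_mem_right]
  obtain ⟨S₀, hS₀, hS₀f, hconf⟩ := exists_validCuts_mem_orthogonal hK hgV hgK happ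
  have hlift : ∀ w ∈ T, ∃ f ∈ validCuts Γ K,
      ∀ x : Vᗮ, (inner ℝ f (x : E) : ℝ) = inner ℝ w x := by
    intro w hw
    obtain ⟨⟨f₀, hf₀, rfl⟩, hwK⟩ := hT hw
    obtain ⟨f, hf, hfV⟩ := exists_validCuts_lift hK hc hgK happ hf₀ (fun x hx hxV => by
      have := hwK ⟨x, hxV⟩ hx
      exact (hinn f₀ ⟨x, hxV⟩).symm.trans_lt this)
    refine ⟨f, hf, fun x => ?_⟩
    have h0 : inner ℝ (f - f₀) (x : E) = (0 : ℝ) := (Submodule.mem_orthogonal _ _).1 x.2 _ hfV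
    rw [inner_sub_left, sub_eq_zero] at h0
    rw [h0]
    exact (hinn f₀ x).symm
  choose! ℓ hℓ hℓx using hlift
  refine ⟨S₀ ∪ ℓ '' T, Set.union_subset hS₀ (Set.image_subset_iff.2 hℓ),
    hS₀f.union (hTf.image _), fun x hx => ?_⟩
  have hxV : 0 ≤ (inner ℝ g x : ℝ) → x ∈ Vᗮ := hconf x fun f hf => hx.2 f (Or.inl hf)
  refine ⟨?_, fun h0 f hf => ?_⟩
  · by_contra! hpos
    have := (Submodule.mem_orthogonal _ _).1 (hxV hpos.le) g hgV
    linarith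
  · lift x to Vᗮ using hxV h0.ge
    rw [← hinn f x]
    refine hgen x ⟨by rw [hinn]; exact hx.1, fun w hw => ?_⟩ _ ⟨⟨f, hf.1, rfl⟩, fun y hy => ?_⟩
    · rw [← hℓx w hw]
      exact hx.2 _ (Or.inr ⟨w, hw, rfl⟩)
    · exact (hinn f y).trans_lt (hf.2 _ hy)

/-! ### Local finiteness in the direction and the induction -/

/-- For the directions close to `g`, the cuts are implied by finitely many of them once this is
known on the face where `g` vanishes. -/
lemma exists_validCuts_nhds_of_face [FiniteDimensional ℝ E] {Γ : AddSubgroup E} {u : E}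
    {K S : Set E} (hSf : S.Finite) (hb : Bornology.IsBounded (slicedCone u S)) {g : E}
    (hface : ∀ x ∈ slicedCone u S, inner ℝ g x ≤ (0 : ℝ) ∧
      (inner ℝ g x = (0 : ℝ) → ∀ f ∈ validCuts Γ K, inner ℝ f x ≤ (0 : ℝ))) :
    ∃ U ∈ 𝓝 g, ∀ f ∈ validCuts Γ K, ‖f‖⁻¹ • f ∈ U →
      ∀ x ∈ slicedCone u S, inner ℝ f x ≤ (0 : ℝ) := by
  -- Only the vertices with g < 0 need g' near g; at those with g = 0 the hypothesis `hface` already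
  -- gives every cut.
  have hev : ∀ᶠ g' in 𝓝 g, ∀ x ∈ (slicedCone u S).extremePoints ℝ,
      (inner ℝ g x : ℝ) < 0 → (inner ℝ g' x : ℝ) < 0 := by
    rw [eventually_all_finite (finite_extremePoints_slicedCone u hSf)]
    intro x _
    by_cases h : (inner ℝ g x : ℝ) < 0
    · have hc : Continuous fun g' : E => (inner ℝ g' x : ℝ) := by fun_prop
      exact ((hc.tendsto g).eventually_lt_const h).mono fun _ h _ => h
    · exact Eventually.of_forall fun _ h' => absurd h' h
  refine ⟨_, hev, fun f hf hfU => inner_nonpos_of_extremePoints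
    (Metric.isCompact_of_isClosed_isBounded (isClosed_slicedCone u S) hb)
    (convex_slicedCone u S) f fun x hx => ?_⟩
  rcases (hface x hx.1).1.lt_or_eq with h | h
  · have h1 : (inner ℝ (‖f‖⁻¹ • f) x : ℝ) < 0 := hfU x hx h
    rw [real_inner_smul_left] at h1
    by_contra! hpos
    have := mul_nonneg (inv_nonneg.2 (norm_nonneg f)) hpos.le
    linarith
  · exact (hface x hx.1).2 h f hf

/-- If `g` is positive somewhere on `K`, then only finitely many valid cuts have a direction
close to `g`. -/
lemma exists_nhds_finite_validCuts [FiniteDimensional ℝ E] {Γ : AddSubgroup E}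
    (hΓ : ∃ ε > 0, ∀ f ∈ Γ, ‖f‖ < ε → f = 0) {K : Set E} {g y : E} (hy : y ∈ K)
    (hgy : 0 < (inner ℝ g y : ℝ)) :
    ∃ U ∈ 𝓝 g, {f ∈ validCuts Γ K | ‖f‖⁻¹ • f ∈ U}.Finite := by
  have hc : Continuous fun g' : E => (inner ℝ g' y : ℝ) := by fun_prop
  -- Directions taking a value above ⟨g, y⟩ / 2 at y: since ⟨f, y⟩ < 1, this forces ‖f‖ ≤ 2 / ⟨g,
  -- y⟩.
  refine ⟨_, (hc.tendsto g).eventually_const_lt (half_lt_self hgy), ?_⟩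
  refine (finite_inter_closedBall_of_discrete hΓ (2 / inner ℝ g y)).subset ?_
  rintro f ⟨hf, hfU⟩
  refine ⟨hf.1, ?_⟩
  have h1 : (inner ℝ g y : ℝ) / 2 < inner ℝ (‖f‖⁻¹ • f) y := hfU
  rw [real_inner_smul_left] at h1
  rcases (norm_nonneg f).eq_or_lt with h0 | h0
  · rw [← h0]; positivity
  · have h2 := hf.2 y hy
    have h3 := mul_lt_mul_of_pos_left h1 h0
    rw [mul_inv_cancel_left₀ h0.ne'] at h3
    rw [le_div_iff₀ hgy]
    linarith

/-- The Chvátal–Gomory cuts of a compact convex set with respect to a lattice `Γ` of linear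
functionals are implied by finitely many of them. -/
theorem exists_finite_validCuts (d : ℕ) : ∀ (E : Type v) [NormedAddCommGroup E]
    [InnerProductSpace ℝ E] [FiniteDimensional ℝ E], Module.finrank ℝ E = d →
    ∀ (Γ : AddSubgroup E), (∃ ε > 0, ∀ f ∈ Γ, ‖f‖ < ε → f = 0) →
    Submodule.span ℝ (Γ : Set E) = ⊤ → ∀ u ∈ Γ, ∀ K : Set E, IsCompact K → Convex ℝ K →
    (∀ y ∈ K, inner ℝ u y = (1 : ℝ)) →
    ∃ S ⊆ validCuts Γ K, S.Finite ∧
      ∀ x ∈ slicedCone u S, ∀ f ∈ validCuts Γ K, inner ℝ f x ≤ (0 : ℝ) := by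
  induction d using Nat.strong_induction_on with
  | _ d ih =>
  intro E _ _ _ hd Γ hΓ hspan u hu K hK hc hKu
  obtain ⟨S₀, hS₀, hS₀f, hbdd⟩ := exists_validCuts_isBounded hspan hu hK hKu
  have hloc : ∀ g ∈ Metric.sphere (0 : E) 1, ∃ U ∈ 𝓝 g, ∃ S ⊆ validCuts Γ K, S.Finite ∧
      ∀ f ∈ validCuts Γ K, ‖f‖⁻¹ • f ∈ U → ∀ x ∈ slicedCone u S, inner ℝ f x ≤ (0 : ℝ) := by
    intro g hg
    by_cases hpos : ∃ y ∈ K, 0 < (inner ℝ g y : ℝ)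
    · obtain ⟨y, hy, hgy⟩ := hpos
      obtain ⟨U, hU, hfin⟩ := exists_nhds_finite_validCuts hΓ hy hgy
      exact ⟨U, hU, _, Set.sep_subset _ _, hfin, fun f hf hfU x hx => hx.2 f ⟨hf, hfU⟩⟩
    · push Not at hpos
      obtain ⟨V, hgV, ⟨ε, hε, hdisc⟩, happ⟩ := exists_rational_hull hspan g
      have hlt : Module.finrank ℝ Vᗮ < d := by
        rw [← hd]
        refine Submodule.finrank_lt fun htop => ?_
        rw [Submodule.orthogonal_eq_top_iff] at htop
        rw [htop, Submodule.mem_bot] at hgV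
        rw [hgV, mem_sphere_zero_iff_norm, norm_zero] at hg
        exact zero_ne_one hg
      -- The section K ∩ Vᗮ may be empty, which is why the induction does not assume K non-empty.
      obtain ⟨T, hT, hTf, hgen⟩ := ih _ hlt Vᗮ rfl
        (Γ.map (Vᗮ.orthogonalProjectionOnto : E →+ Vᗮ))
        (by
          refine ⟨ε, hε, ?_⟩
          rintro _ ⟨f, hf, rfl⟩ hlt
          have := hdisc f hf hlt
          exact Submodule.orthogonalProjectionOnto_eq_zero_iff.2
            (V.le_orthogonal_orthogonal this))
        (by
          have h1 := congrArg (Submodule.map Vᗮ.orthogonalProjectionOnto.toLinearMap) hspan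
          rw [Submodule.map_span, Submodule.map_top] at h1
          refine h1.trans (LinearMap.range_eq_top.2 fun x => ⟨x, ?_⟩)
          exact Submodule.orthogonalProjectionOnto_mem_subspace_eq_self x)
        (Vᗮ.orthogonalProjectionOnto u) ⟨u, hu, rfl⟩ ((↑) ⁻¹' K)
        (Vᗮ.closed_of_finiteDimensional.isClosedEmbedding_subtypeVal.isCompact_preimage hK)
        (hc.linear_preimage Vᗮ.subtype)
        (fun y hy => by
          rw [Submodule.inner_orthogonalProjectionOnto_eq_of_mem_right]
          exact hKu _ hy)
      obtain ⟨S, hS, hSf, hface⟩ := exists_validCuts_face hK hc hgV hpos happ hT hTf hgen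
      -- Adjoining S₀ makes the polyhedron bounded, so that its vertices control it.
      obtain ⟨U, hU, hUS⟩ := exists_validCuts_nhds_of_face (hS₀f.union hSf)
        (hbdd.subset (slicedCone_anti u Set.subset_union_left))
        (fun x hx => hface x (slicedCone_anti u Set.subset_union_right hx))
      exact ⟨U, hU, _, Set.union_subset hS₀ hS, hS₀f.union hSf, hUS⟩
  choose! U hU S hS hSf hUS using hloc
  obtain ⟨t, ht, hcov⟩ := (isCompact_sphere (0 : E) 1).elim_nhds_subcover U hU
  refine ⟨⋃ g ∈ t, S g, Set.iUnion₂_subset fun g hg => hS g (ht g hg),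
    t.finite_toSet.biUnion fun g hg => hSf g (ht g hg), fun x hx f hf => ?_⟩
  rcases eq_or_ne f 0 with rfl | hf0
  · simp
  · have hfs : ‖f‖⁻¹ • f ∈ Metric.sphere (0 : E) 1 := by
      rw [mem_sphere_zero_iff_norm, norm_smul, norm_inv, norm_norm,
        inv_mul_cancel₀ (norm_ne_zero_iff.2 hf0)]
    obtain ⟨g, hg, hfg⟩ := Set.mem_iUnion₂.1 (hcov hfs)
    exact hUS g (ht g hg) f hf hfg x
      (slicedCone_anti u (Set.subset_biUnion_of_mem (u := fun g => S g) hg) hx)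

end GeneralTheory

/-! ### Homogenization and the Chvátal–Gomory closure -/

section ChvatalGomory

/-- The lattice of integer vectors. -/
def integerLattice (ι : Type*) [Fintype ι] : AddSubgroup (EuclideanSpace ℝ ι) where
  carrier := {f | ∀ i, ∃ k : ℤ, f i = k}
  add_mem' hf hg i := by
    obtain ⟨k, hk⟩ := hf i
    obtain ⟨l, hl⟩ := hg i
    exact ⟨k + l, by simp [hk, hl]⟩
  zero_mem' i := ⟨0, by simp⟩
  neg_mem' hf i := by
    obtain ⟨k, hk⟩ := hf i
    exact ⟨-k, by simp [hk]⟩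

lemma integerLattice_discrete (ι : Type*) [Fintype ι] :
    ∃ ε > 0, ∀ f ∈ integerLattice ι, ‖f‖ < ε → f = 0 := by
  refine ⟨1, one_pos, fun f hf hlt => ?_⟩
  ext i
  obtain ⟨k, hk⟩ := hf i
  have h1 : ‖f i‖ < 1 := (PiLp.norm_apply_le f i).trans_lt hlt
  rw [hk, Real.norm_eq_abs] at h1
  have h2 : |k| < 1 := by exact_mod_cast h1
  rw [hk, Int.abs_lt_one_iff.1 h2]
  simp

lemma span_integerLattice (ι : Type*) [Fintype ι] :
    Submodule.span ℝ (integerLattice ι : Set (EuclideanSpace ℝ ι)) = ⊤ := by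
  classical
  rw [eq_top_iff, ← (EuclideanSpace.basisFun ι ℝ).toBasis.span_eq]
  refine Submodule.span_mono ?_
  rintro _ ⟨i, rfl⟩ j
  refine ⟨if j = i then 1 else 0, ?_⟩
  simp

variable {n : ℕ}

/-- The embedding `x ↦ (x, 1)` of `ℝⁿ` as an affine hyperplane of `ℝⁿ⁺¹`. -/
def homogenize (x : EuclideanSpace ℝ (Fin n)) : EuclideanSpace ℝ (Option (Fin n)) :=
  WithLp.toLp 2 fun o => o.elim 1 fun i => x i

/-- The functional on `ℝⁿ⁺¹` that restricts to `x ↦ ⟨a, x⟩ - k`. -/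
def cutVec (a : Fin n → ℤ) (k : ℤ) : EuclideanSpace ℝ (Option (Fin n)) :=
  WithLp.toLp 2 fun o => o.elim (-(k : ℝ)) fun i => (a i : ℝ)

lemma inner_intVec (a : Fin n → ℤ) (x : EuclideanSpace ℝ (Fin n)) :
    (inner ℝ (intVec a) x : ℝ) = ∑ i, (a i : ℝ) * x i := by
  simp [intVec, PiLp.inner_apply, mul_comm]

lemma inner_cutVec_homogenize (a : Fin n → ℤ) (k : ℤ) (x : EuclideanSpace ℝ (Fin n)) :
    (inner ℝ (cutVec a k) (homogenize x) : ℝ) = inner ℝ (intVec a) x - k := by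
  rw [inner_intVec]
  simp [cutVec, homogenize, PiLp.inner_apply, Fintype.sum_option, mul_comm]
  ring

lemma cutVec_mem (a : Fin n → ℤ) (k : ℤ) : cutVec a k ∈ integerLattice (Option (Fin n)) := by
  rintro (_ | i)
  · exact ⟨-k, by simp [cutVec]⟩
  · exact ⟨a i, by simp [cutVec]⟩

lemma exists_eq_cutVec {f : EuclideanSpace ℝ (Option (Fin n))}
    (hf : f ∈ integerLattice (Option (Fin n))) : ∃ a k, f = cutVec a k := by
  choose c hc using hf
  refine ⟨fun i => c (some i), -c none, ?_⟩
  ext (_ | i) <;> simp [cutVec, hc]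

lemma continuous_homogenize : Continuous (homogenize (n := n)) := by
  refine (PiLp.continuous_toLp 2 _).comp (continuous_pi ?_)
  rintro (_ | i)
  · exact continuous_const
  · exact (by fun_prop : Continuous fun x : EuclideanSpace ℝ (Fin n) => x i)

lemma Convex.homogenize_image {K : Set (EuclideanSpace ℝ (Fin n))} (hK : Convex ℝ K) :
    Convex ℝ (homogenize '' K) := by
  rintro _ ⟨x, hx, rfl⟩ _ ⟨y, hy, rfl⟩ a b ha hb hab
  refine ⟨a • x + b • y, hK hx hy ha hb hab, ?_⟩
  ext (_ | i) <;> simp [homogenize, hab]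

lemma inner_le_supportFn {K : Set (EuclideanSpace ℝ (Fin n))} (hK : IsCompact K)
    (v : EuclideanSpace ℝ (Fin n)) {y : EuclideanSpace ℝ (Fin n)} (hy : y ∈ K) :
    inner ℝ v y ≤ supportFn K v :=
  le_csSup (hK.image (by fun_prop : Continuous fun x => (inner ℝ v x : ℝ))).bddAbove ⟨y, hy, rfl⟩

lemma supportFn_lt {K : Set (EuclideanSpace ℝ (Fin n))} (hne : K.Nonempty) (hK : IsCompact K)
    {v : EuclideanSpace ℝ (Fin n)} {c : ℝ} (h : ∀ y ∈ K, inner ℝ v y < c) :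
    supportFn K v < c := by
  obtain ⟨y, hy, he⟩ := (hK.image (by fun_prop : Continuous fun x => (inner ℝ v x : ℝ))).sSup_mem
    (hne.image _)
  rw [supportFn, ← he]
  exact h y hy

/-- Rounding down is the strict bound 1 in disguise: ⌊h⌋ ≤ k means h < k + 1. As the supremum is
attained on the non-empty compact K, this is a strict inequality at each point of K. -/
lemma cutVec_mem_validCuts_iff {K : Set (EuclideanSpace ℝ (Fin n))} (hne : K.Nonempty)
    (hK : IsCompact K) (a : Fin n → ℤ) (k : ℤ) :
    cutVec a k ∈ validCuts (integerLattice (Option (Fin n))) (homogenize '' K) ↔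
      ⌊supportFn K (intVec a)⌋ ≤ k := by
  have hval : cutVec a k ∈ validCuts (integerLattice (Option (Fin n))) (homogenize '' K) ↔
      ∀ y ∈ K, inner ℝ (intVec a) y < (k : ℝ) + 1 := by
    simp only [validCuts, Set.mem_ofPred_eq, cutVec_mem, true_and, Set.forall_mem_image,
      inner_cutVec_homogenize, sub_lt_iff_lt_add']
  rw [hval, ← Int.lt_add_one_iff, Int.floor_lt]
  push_cast
  exact ⟨supportFn_lt hne hK, fun h y hy => (inner_le_supportFn hK _ hy).trans_lt h⟩

lemma mem_cgCuts {K : Set (EuclideanSpace ℝ (Fin n))} {S : Set (Fin n → ℤ)}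
    {x : EuclideanSpace ℝ (Fin n)} : x ∈ cgCuts K S ↔
      ∀ a ∈ S, inner ℝ (intVec a) x ≤ (⌊supportFn K (intVec a)⌋ : ℝ) := by
  simp [cgCuts]

theorem exists_finite_cgClosure_eq {K : Set (EuclideanSpace ℝ (Fin n))} (hne : K.Nonempty)
    (hK : IsCompact K) (hc : Convex ℝ K) :
    ∃ S : Set (Fin n → ℤ), S.Finite ∧ cgClosure K = cgCuts K S := by
  -- The functional (0, 1) is the constant 1 on the lifted space and plays the role of u.
  have hu : ∀ x : EuclideanSpace ℝ (Fin n),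
      inner ℝ (cutVec 0 (-1)) (homogenize x) = (1 : ℝ) := fun x => by
    rw [inner_cutVec_homogenize, inner_intVec]; simp
  obtain ⟨S, hS, hSf, hgen⟩ := exists_finite_validCuts _ (EuclideanSpace ℝ (Option (Fin n))) rfl
    _ (integerLattice_discrete _) (span_integerLattice _) (cutVec 0 (-1)) (cutVec_mem _ _)
    (homogenize '' K) (hK.image continuous_homogenize) hc.homogenize_image
    (Set.forall_mem_image.2 fun x _ => hu x)
  have hrep : ∀ f ∈ S, ∃ a k, f = cutVec a k := fun f hf => exists_eq_cutVec (hS hf).1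
  choose! a k hak using hrep
  refine ⟨a '' S, hSf.image a, Set.Subset.antisymm
    (fun x hx => mem_cgCuts.2 fun b _ => mem_cgCuts.1 hx b trivial) fun x hx =>
    mem_cgCuts.2 fun b _ => ?_⟩
  have hval := (cutVec_mem_validCuts_iff hne hK b ⌊supportFn K (intVec b)⌋).2 le_rfl
  have := hgen (homogenize x) ⟨hu x, fun f hf => ?_⟩ _ hval
  · rw [inner_cutVec_homogenize] at this
    linarith
  -- The right-hand side `k f` may exceed the floor; the tight cut for `a f` implies the weaker one.
  · have hfv := hS hf
    rw [hak f hf, cutVec_mem_validCuts_iff hne hK] at hfv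
    rw [hak f hf, inner_cutVec_homogenize]
    have h1 := mem_cgCuts.1 hx (a f) ⟨f, hf, rfl⟩
    have h2 : ((⌊supportFn K (intVec (a f))⌋ : ℤ) : ℝ) ≤ k f := by exact_mod_cast hfv
    linarith

lemma isRationalPolyhedron_cgCuts (K : Set (EuclideanSpace ℝ (Fin n))) {S : Set (Fin n → ℤ)}
    (hS : S.Finite) : IsRationalPolyhedron (cgCuts K S) := by
  obtain ⟨m, e, -, rfl⟩ := hS.fin_param
  refine ⟨m, fun i j => e i j, fun i => ⌊supportFn K (intVec (e i))⌋, ?_⟩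
  ext x
  simp [mem_cgCuts, inner_intVec]

/-- The cuts for the vectors ±eᵢ alone bound every coordinate. -/
lemma isBounded_cgClosure (K : Set (EuclideanSpace ℝ (Fin n))) :
    Bornology.IsBounded (cgClosure K) := by
  refine (EuclideanSpace.basisFun (Fin n) ℝ).isBounded_of_forall_inner fun i => ?_
  refine ⟨max ⌊supportFn K (intVec (Pi.single i 1))⌋ ⌊supportFn K (intVec (Pi.single i (-1)))⌋,
    fun x hx => ?_⟩
  have hval : ∀ c : ℤ, (inner ℝ (intVec (Pi.single i c)) x : ℝ) = c * x i := fun c => by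
    rw [inner_intVec, Finset.sum_eq_single i (fun j _ hj => by simp [hj]) (by simp)]
    simp
  have h1 := mem_cgCuts.1 hx (Pi.single i 1) trivial
  have h2 := mem_cgCuts.1 hx (Pi.single i (-1)) trivial
  rw [hval] at h1 h2
  rw [EuclideanSpace.basisFun_inner, abs_le']
  push_cast at h1 h2
  exact ⟨le_max_of_le_left (by linarith), le_max_of_le_right (by linarith)⟩

end ChvatalGomory

theorem theorem1 (n : ℕ) (K : Set (EuclideanSpace ℝ (Fin n)))
    (hne : K.Nonempty) (hcomp : IsCompact K) (hconv : Convex ℝ K) :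
    (∃ S : Set (Fin n → ℤ), S.Finite ∧ cgClosure K = cgCuts K S) ∧
      IsRationalPolytope (cgClosure K) := by
  obtain ⟨S, hS, hKS⟩ := exists_finite_cgClosure_eq hne hcomp hconv
  exact ⟨⟨S, hS, hKS⟩, hKS ▸ isRationalPolyhedron_cgCuts K hS, isBounded_cgClosure K⟩
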